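/- Let $\tau$ be the morphism on words over $\{0,1,2\}$ given by $\tau(0)=012$, $\tau(1)=02$, $\tau(2)=1$, and let $\mathtt{vtm}=\tau^\omega(0)=012021012\cdots$ be its infinite fixed point starting with $0$. A word is squarefree if it has no factor $uu$ with $u$ non-empty. A position $j\ge 0$ of a squarefree infinite word $w$ is called disposable if, writing $w=uav$ with $a$ a letter and $|u|=j$, the word $uv$ is squarefree. Let $\mathcal A$ be the deterministic finite automaton over the alphabet $\{0,1\}$ with states $0,1,\dots,8$, initial state $0$, set of accepting states $\{0,2,8\}$, and the following transitions, where $q\mapsto(r,s)$ means that $\mathcal A$ moves from state $q$ to state $r$ on reading $0$ and to state $s$ on reading $1$: $$0\mapsto(0,1),\quad 1\mapsto(2,3),\quad 2\mapsto(4,5),\quad 3\mapsto(6,5),\quad 4\mapsto(7,1),\quad 5\mapsto(7,3),\quad 6\mapsto(8,5),\quad 7\mapsto(4,5),\quad 8\mapsto(7,1).$$ Then: (a) A position $j\ge 0$ of $\mathtt{vtm}$ is disposable if and only if $\mathcal A$ accepts the base-2 representation of $j$, read with the most significant digit first. This holds for the representation without leading zeros (the empty word for $j=0$) and for the representations with any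 number of leading zeros. (b) The set of differences $j-i$, where $0<i<j$ are disposable positions of $\mathtt{vtm}$ with no disposable position strictly between them, is exactly $\{6,10,26\}$. -/

import Mathlib

namespace DisposableVtm

/-- An infinite word over `α` (positions start at `0`) is squarefree if it has no factor `u u`
with `u` non-empty. -/
def IsSquarefree {α : Type*} (w : ℕ → α) : Prop :=
  ∀ i n : ℕ, 0 < n → ¬ ∀ k < n, w (i + k) = w (i + n + k)

/-- The infinite word obtained from `w` by deleting the letter at position `j`: if `w = u a v`
with `a` a letter and `u` of length `j`, this is `u v`. -/
def deleteAt {α : Type*} (w : ℕ → α) (j : ℕ) : ℕ → α :=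
  fun n => if n < j then w n else w (n + 1)

/-- Position `j` of the squarefree infinite word `w` is disposable: deleting the letter at `j`
leaves a squarefree word. -/
def IsDisposable {α : Type*} (w : ℕ → α) (j : ℕ) : Prop :=
  IsSquarefree w ∧ IsSquarefree (deleteAt w j)

/-- The morphism `0 ↦ 012`, `1 ↦ 02`, `2 ↦ 1` on letters. -/
def tauLetter : Fin 3 → List (Fin 3) :=
  ![[0, 1, 2], [0, 2], [1]]

/-- The morphism `τ` on finite words. -/
def tau (u : List (Fin 3)) : List (Fin 3) :=
  u.flatMap tauLetter

/-- The infinite word `τ^ω(0)`, the limit of the words `τ^n(0)`. -/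
def vtm (n : ℕ) : Fin 3 :=
  (tau^[n] [0]).getD n 0

theorem tau_append (u v : List (Fin 3)) : tau (u ++ v) = tau u ++ tau v := by
  simp [tau]

theorem tau_ne_nil {u : List (Fin 3)} (h : u ≠ []) : tau u ≠ [] := by
  cases u with
  | nil => exact absurd rfl h
  | cons a u => fin_cases a <;> simp [tau, tauLetter]

theorem exists_iterate_succ (n : ℕ) : ∃ s ≠ [], tau^[n + 1] [0] = tau^[n] [0] ++ s := by
  induction n with
  | zero => exact ⟨[1, 2], by simp, by simp [tau, tauLetter]⟩
  | succ n ih =>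
    obtain ⟨s, hs, h⟩ := ih
    refine ⟨tau s, tau_ne_nil hs, ?_⟩
    rw [Function.iterate_succ_apply', h, tau_append, ← Function.iterate_succ_apply' tau, h]

theorem lt_length_iterate (n : ℕ) : n < (tau^[n] [0]).length := by
  induction n with
  | zero => simp
  | succ n ih =>
    obtain ⟨s, hs, h⟩ := exists_iterate_succ n
    have := List.length_pos_of_ne_nil hs
    rw [h, List.length_append]
    omega

theorem iterate_prefix {m n : ℕ} (h : m ≤ n) : tau^[m] [0] <+: tau^[n] [0] := by
  induction n, h using Nat.le_induction with
  | base => exact List.prefix_rfl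
  | succ n _ ih =>
    obtain ⟨s, -, hs⟩ := exists_iterate_succ n
    rw [hs]
    exact ih.trans (List.prefix_append _ _)

/-- Every `τ^n(0)` is a prefix of `vtm`. -/
theorem iterate_getElem (n i : ℕ) (h : i < (tau^[n] [0]).length) :
    (tau^[n] [0])[i] = vtm i := by
  have hi := lt_length_iterate i
  rw [vtm, List.getD_eq_getElem _ _ hi]
  rcases le_total n i with hn | hn
  · exact (iterate_prefix hn).getElem h
  · exact ((iterate_prefix hn).getElem hi).symm

/-- The automaton `dispo_pos`, reading base-2 digits (`false` is `0`, `true` is `1`), most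
significant digit first. The `q`-th entry of the table lists the successors of state `q` under
`0` and under `1`. -/
def dispoPos : DFA Bool (Fin 9) where
  step q b :=
    let r : Fin 9 × Fin 9 :=
      ![(0, 1), (2, 3), (4, 5), (6, 5), (7, 1), (7, 3), (8, 5), (4, 5), (7, 1)] q
    if b then r.2 else r.1
  start := 0
  accept := {0, 2, 8}

/-- The base-2 representation of `j`, most significant digit first, without leading zeros
(so that `0` is represented by the empty word). -/
def binaryRep (j : ℕ) : List Bool :=
  (Nat.bits j).reverse

end DisposableVtm

/-!
The letter `1` of `vtm` marks the positions where two consecutive letters of the Thue–Morse word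
`t` agree, and `0`, `2` its ascents and descents. Since `t` has no overlap, `vtm` is squarefree.

In `vtm` a letter at an even position is determined by the three letters to its left, and also by
the three letters to its right. If deleting it created a square of period at least `5`, one of
these contexts would be repeated, without a gap, in the other half of the square, and the letter
repeated there would force two equal adjacent letters in `vtm` or a longer square. So only squares
of period at most `4` matter; they live in three consecutive images under the third power of the
Thue–Morse morphism, and inspecting these shows that the disposable positions are `0`, `2`, and
`8 n + 4`, `8 n + 10` for every `n` with `vtm n = 1`.

The same description holds for the automaton, because its states other than `0` are the disjoint
union of `{1, 5}`, reached by the `n` with `vtm n = 1`, of `{2, 6, 7}`, reached by the `n` with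
`vtm (n - 1) = 1`, and of `{3, 4, 8}`. The occurrences of `1` in `vtm` are `2` or `4` apart, which
leaves the gaps `6`, `8 * 2 - 6` and `8 * 4 - 6` between disposable positions.
-/

namespace DisposableVtm

/-! ### Overlap-free binary words and their difference words -/

/-- An infinite word is overlap-free if it has no factor `u u a` with `u` non-empty and `a` the
first letter of `u`. -/
def IsOverlapFree {α : Type*} (w : ℕ → α) : Prop :=
  ∀ i n : ℕ, 0 < n → ¬∀ k ≤ n, w (i + k) = w (i + n + k)

/-- The letter `1 - (b - a)` encoding the passage from the bit `a` to the bit `b`. -/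
def diffLetter (a b : Bool) : Fin 3 :=
  if a = b then 1 else if a then 2 else 0

/-- The difference word of a binary word, with its letters encoded by `diffLetter`. -/
def diffWord (t : ℕ → Bool) (n : ℕ) : Fin 3 :=
  diffLetter (t n) (t (n + 1))

theorem diffLetter_eq_one_iff {a b : Bool} : diffLetter a b = 1 ↔ a = b := by
  decide +revert

theorem diffLetter_right_injective (a : Bool) : Function.Injective (diffLetter a) := by
  decide +revert

theorem eq_of_diffLetter_eq {a b a' b' : Bool} (ha : a ≠ a')
    (h : diffLetter a b = diffLetter a' b') : b = a ∧ b' = a' := by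
  decide +revert

theorem IsOverlapFree.isSquarefree_diffWord {t : ℕ → Bool} (ht : IsOverlapFree t) :
    IsSquarefree (diffWord t) := by
  intro i n hn hsq
  by_cases hi : t i = t (i + n)
  · refine ht i n hn fun k => ?_
    induction k with
    | zero => exact fun _ => hi
    | succ k ih =>
      intro hk
      have hletter := hsq k hk
      rw [diffWord, diffWord, ih (by omega)] at hletter
      exact diffLetter_right_injective _ hletter
  · have constant : ∀ k ≤ n, t (i + k) = t i ∧ t (i + n + k) = t (i + n) := by
      intro k
      induction k with
      | zero => exact fun _ => ⟨rfl, rfl⟩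
      | succ k ih =>
        intro hk
        have hletter := hsq k hk
        rw [diffWord, diffWord, (ih (by omega)).1, (ih (by omega)).2] at hletter
        exact eq_of_diffLetter_eq hi hletter
    exact hi (constant n le_rfl).1.symm

/-! ### The Thue–Morse word -/

/-- The Thue–Morse word: the parity of the number of binary digits `1` of `n`. -/
def thueMorse (n : ℕ) : Bool :=
  (Nat.bits n).foldr xor false

theorem thueMorse_bit (b : Bool) (n : ℕ) : thueMorse (Nat.bit b n) = xor b (thueMorse n) := by
  rcases eq_or_ne n 0 with rfl | hn
  · cases b <;> rfl
  · simp [thueMorse, Nat.bits_append_bit n b fun h => absurd h hn]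

theorem thueMorse_two_mul (n : ℕ) : thueMorse (2 * n) = thueMorse n := by
  simpa using thueMorse_bit false n

theorem thueMorse_two_mul_add_one (n : ℕ) : thueMorse (2 * n + 1) = !thueMorse n := by
  simpa using thueMorse_bit true n

theorem thueMorse_two_pow_mul_add {s r : ℕ} (hr : r < 2 ^ s) (m : ℕ) :
    thueMorse (2 ^ s * m + r) = xor (thueMorse r) (thueMorse m) := by
  induction s generalizing r with
  | zero =>
    obtain rfl : r = 0 := by omega
    simp [thueMorse]
  | succ s ih =>
    have split_last : 2 ^ (s + 1) * m + r = Nat.bit r.bodd (2 ^ s * m + r.div2) := by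
      conv_lhs => rw [← Nat.bit_bodd_div2 r]
      simp only [Nat.bit_val]
      ring
    have hr_half : r.div2 < 2 ^ s := by
      rw [Nat.div2_val]
      omega
    rw [split_last, thueMorse_bit, ih hr_half, ← Bool.xor_assoc, ← thueMorse_bit r.bodd r.div2,
      Nat.bit_bodd_div2]

theorem thueMorse_two_pow_mul_add_congr {m m' q : ℕ}
    (h : ∀ i < q, thueMorse (m + i) = thueMorse (m' + i)) (s : ℕ) {k : ℕ} (hk : k < 2 ^ s * q) :
    thueMorse (2 ^ s * m + k) = thueMorse (2 ^ s * m' + k) := by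
  have letter (x : ℕ) : thueMorse (2 ^ s * x + k) =
      xor (thueMorse (k % 2 ^ s)) (thueMorse (x + k / 2 ^ s)) := by
    rw [← thueMorse_two_pow_mul_add (Nat.mod_lt k (by positivity)), mul_add, add_assoc,
      Nat.div_add_mod]
  rw [letter, letter, h _ (Nat.div_lt_of_lt_mul hk)]

theorem thueMorse_ne_succ_of_even {n : ℕ} (hn : Even n) : thueMorse n ≠ thueMorse (n + 1) := by
  obtain ⟨m, rfl⟩ := even_iff_exists_two_mul.1 hn
  simp [thueMorse_two_mul, thueMorse_two_mul_add_one]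

theorem thueMorse_ne_succ_or_succ_ne (n : ℕ) :
    thueMorse n ≠ thueMorse (n + 1) ∨ thueMorse (n + 1) ≠ thueMorse (n + 2) :=
  (Nat.even_or_odd n).imp thueMorse_ne_succ_of_even fun h => thueMorse_ne_succ_of_even h.add_one

theorem thueMorse_odd_eq_succ_iff (n : ℕ) :
    thueMorse (2 * n + 1) = thueMorse (2 * n + 2) ↔ thueMorse n ≠ thueMorse (n + 1) := by
  rw [thueMorse_two_mul_add_one, show 2 * n + 2 = 2 * (n + 1) by ring, thueMorse_two_mul]
  exact Bool.not_eq

theorem thueMorse_eq_succ_or_of_odd {n : ℕ} (hn : Odd n) :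
    thueMorse n = thueMorse (n + 1) ∨ thueMorse (n + 2) = thueMorse (n + 3) := by
  obtain ⟨m, rfl⟩ := hn
  exact (thueMorse_ne_succ_or_succ_ne m).imp (thueMorse_odd_eq_succ_iff m).2
    (thueMorse_odd_eq_succ_iff (m + 1)).2

theorem not_overlap_thueMorse_of_odd {n : ℕ} (hn : Odd n) (i : ℕ) :
    ¬∀ k ≤ n, thueMorse (i + k) = thueMorse (i + n + k) := by
  intro h
  obtain rfl | hn3 : n = 1 ∨ 3 ≤ n := by grind
  · exact (thueMorse_ne_succ_or_succ_ne i).elim (· (h 0 (by omega))) (· (h 1 le_rfl))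
  have transfer {k : ℕ} (hk : k < 3) : thueMorse (i + k) = thueMorse (i + k + 1) ↔
      thueMorse (i + n + k) = thueMorse (i + n + k + 1) := by
    rw [h k (by omega), add_assoc i k, h (k + 1) (by omega), add_assoc (i + n) k]
  -- Just one of `i` and `i + n` is odd. At distance `0` or `2` from it two adjacent letters agree,
  -- and `transfer` carries this over to an even position, where adjacent letters differ.
  rcases Nat.even_or_odd i with hi | hi
  · rcases thueMorse_eq_succ_or_of_odd (hi.add_odd hn) with h' | h'
    · exact thueMorse_ne_succ_of_even hi ((transfer (k := 0) (by omega)).2 h')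
    · exact thueMorse_ne_succ_of_even (hi.add even_two) ((transfer (k := 2) (by omega)).2 h')
  · have hin := hi.add_odd hn
    rcases thueMorse_eq_succ_or_of_odd hi with h' | h'
    · exact thueMorse_ne_succ_of_even hin ((transfer (k := 0) (by omega)).1 h')
    · exact thueMorse_ne_succ_of_even (hin.add even_two) ((transfer (k := 2) (by omega)).1 h')

theorem isOverlapFree_thueMorse : IsOverlapFree thueMorse := by
  intro i n hn h
  induction n using Nat.strong_induction_on generalizing i with
  | _ n ih =>
    rcases Nat.even_or_odd' n with ⟨e, rfl | rfl⟩
    · rcases Nat.even_or_odd' i with ⟨m, rfl | rfl⟩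
      · refine ih e (by omega) m (by omega) fun k hk => ?_
        have hletter := h (2 * k) (by omega)
        rwa [← mul_add, ← mul_add, ← mul_add, thueMorse_two_mul, thueMorse_two_mul] at hletter
      · refine ih e (by omega) m (by omega) fun k hk => ?_
        have hletter := h (2 * k) (by omega)
        rwa [show 2 * m + 1 + 2 * k = 2 * (m + k) + 1 by ring,
          show 2 * m + 1 + 2 * e + 2 * k = 2 * (m + e + k) + 1 by ring,
          thueMorse_two_mul_add_one, thueMorse_two_mul_add_one, Bool.not_inj_iff] at hletter
    · exact not_overlap_thueMorse_of_odd ⟨e, rfl⟩ i h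

/-! ### `vtm` as a difference word -/

theorem tau_map_diffWord_range (n : ℕ) :
    tau ((List.range n).map (diffWord thueMorse)) =
      (List.range (2 * n + (thueMorse n).toNat)).map (diffWord thueMorse) := by
  induction n with
  | zero => rfl
  | succ n ih =>
    have h₀ := thueMorse_two_mul n
    have h₁ := thueMorse_two_mul_add_one n
    have h₂ : thueMorse (2 * n + 2) = thueMorse (n + 1) := thueMorse_two_mul (n + 1)
    have h₃ : thueMorse (2 * n + 3) = !thueMorse (n + 1) := thueMorse_two_mul_add_one (n + 1)
    rw [List.range_succ, List.map_append, tau_append, ih]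
    rcases hn : thueMorse n <;> rcases hn' : thueMorse (n + 1) <;>
      simp [tau, tauLetter, diffWord, diffLetter, hn, hn', mul_add, List.range_succ,
        h₀, h₁, h₂, h₃]

theorem exists_iterate_tau_eq_map_range (n : ℕ) :
    ∃ L, tau^[n] [0] = (List.range L).map (diffWord thueMorse) := by
  induction n with
  | zero => exact ⟨1, rfl⟩
  | succ n ih =>
    obtain ⟨L, hL⟩ := ih
    exact ⟨_, by rw [Function.iterate_succ_apply', hL, tau_map_diffWord_range]⟩

theorem vtm_eq_diffWord : vtm = diffWord thueMorse := by
  ext1 n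
  obtain ⟨L, hL⟩ := exists_iterate_tau_eq_map_range n
  have hn := lt_length_iterate n
  rw [vtm, List.getD_eq_getElem _ _ hn]
  simp only [hL, List.getElem_map, List.getElem_range]

theorem isSquarefree_vtm : IsSquarefree vtm :=
  vtm_eq_diffWord ▸ isOverlapFree_thueMorse.isSquarefree_diffWord

theorem vtm_eq_one_iff {n : ℕ} : vtm n = 1 ↔ thueMorse n = thueMorse (n + 1) := by
  rw [vtm_eq_diffWord, diffWord, diffLetter_eq_one_iff]

theorem vtm_two_mul_ne_one (n : ℕ) : vtm (2 * n) ≠ 1 :=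
  mt vtm_eq_one_iff.1 (thueMorse_ne_succ_of_even (even_two_mul n))

theorem vtm_two_mul_add_one_eq_one_iff (n : ℕ) : vtm (2 * n + 1) = 1 ↔ vtm n ≠ 1 := by
  rw [ne_eq, vtm_eq_one_iff, vtm_eq_one_iff, thueMorse_odd_eq_succ_iff]

theorem odd_of_vtm_eq_one {n : ℕ} (hn : vtm n = 1) : Odd n :=
  Nat.not_even_iff_odd.1 fun h => mt vtm_eq_one_iff.1 (thueMorse_ne_succ_of_even h) hn

theorem vtm_eq_one_or_of_odd {n : ℕ} (hn : Odd n) : vtm n = 1 ∨ vtm (n + 2) = 1 := by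
  rw [vtm_eq_one_iff, vtm_eq_one_iff]
  exact thueMorse_eq_succ_or_of_odd hn

theorem vtm_succ_ne_one {n : ℕ} (hn : vtm n = 1) : vtm (n + 1) ≠ 1 := fun h =>
  absurd (odd_of_vtm_eq_one h) (by simpa using (odd_of_vtm_eq_one hn).add_one)

theorem vtm_add_three_ne_one {n : ℕ} (hn : vtm n = 1) : vtm (n + 3) ≠ 1 := fun h =>
  absurd (odd_of_vtm_eq_one h) (by have := odd_of_vtm_eq_one hn; grind)

theorem vtm_ne_add_two_of_succ_eq_one {n : ℕ} (hn : vtm (n + 1) = 1) : vtm n ≠ vtm (n + 2) := by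
  have hcube := thueMorse_ne_succ_or_succ_ne n
  rw [vtm_eq_one_iff] at hn
  rw [vtm_eq_diffWord, diffWord, diffWord, ← hn]
  grind [diffLetter]

/-! ### Squares created by deleting a letter -/

section Deletion

variable {α : Type*} {w : ℕ → α} {j m n : ℕ}

/-- The factor of length `2 n` of `w` that starts at `i` is a square. -/
def IsSquareAt (w : ℕ → α) (i n : ℕ) : Prop :=
  ∀ k < n, w (i + k) = w (i + n + k)

/-- Deleting the letter of `w` at `j` leaves a square of period `n` with letters from both sides
of `j`. -/
def CreatesSquare (w : ℕ → α) (j n : ℕ) : Prop :=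
  ∃ i < j, j < i + 2 * n ∧ IsSquareAt (deleteAt w j) i n

instance [DecidableEq α] (w : ℕ → α) (i n : ℕ) : Decidable (IsSquareAt w i n) :=
  inferInstanceAs (Decidable (∀ k < n, w (i + k) = w (i + n + k)))

instance [DecidableEq α] (w : ℕ → α) (j n : ℕ) : Decidable (CreatesSquare w j n) :=
  inferInstanceAs (Decidable (∃ i < j, j < i + 2 * n ∧ IsSquareAt (deleteAt w j) i n))

theorem deleteAt_of_lt (h : n < j) : deleteAt w j n = w n :=
  if_pos h

theorem deleteAt_of_le (h : j ≤ n) : deleteAt w j n = w (n + 1) :=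
  if_neg h.not_gt

theorem IsSquarefree.ne_succ (hw : IsSquarefree w) (n : ℕ) : w n ≠ w (n + 1) := fun h =>
  hw n 1 one_pos fun k hk => by
    obtain rfl : k = 0 := by omega
    exact h

theorem IsSquarefree.isSquarefree_deleteAt_iff (hw : IsSquarefree w) :
    IsSquarefree (deleteAt w j) ↔ ∀ n, ¬CreatesSquare w j n := by
  refine ⟨fun h n ⟨i, hi, hj, hsq⟩ => h i n (by omega) hsq, fun h i n hn hsq => ?_⟩
  rcases le_or_gt j i with hi | hi
  · refine hw (i + 1) n hn fun k hk => ?_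
    have hletter := hsq k hk
    rw [deleteAt_of_le (by omega), deleteAt_of_le (by omega)] at hletter
    rwa [add_right_comm i 1 k, add_right_comm i 1 n, add_right_comm (i + n) 1 k]
  rcases le_or_gt (i + 2 * n) j with hj | hj
  · refine hw i n hn fun k hk => ?_
    have hletter := hsq k hk
    rwa [deleteAt_of_lt (by omega), deleteAt_of_lt (by omega)] at hletter
  · exact h n ⟨i, hi, hj, hsq⟩

theorem deleteAt_add_congr {v : ℕ → α} {b b' N : ℕ} (h : ∀ k < N, v (b + k) = w (b' + k)) {k : ℕ}
    (hk : k + 1 < N) : deleteAt v (b + j) (b + k) = deleteAt w (b' + j) (b' + k) := by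
  simp only [deleteAt, add_lt_add_iff_left, add_assoc]
  rw [h k (by omega), h (k + 1) hk]

theorem CreatesSquare.of_agree {v : ℕ → α} {b b' : ℕ} (hj : 2 * n ≤ j + 1)
    (h : ∀ k < j + 2 * n, v (b + k) = w (b' + k)) (hv : CreatesSquare v (b + j) n) :
    CreatesSquare w (b' + j) n := by
  obtain ⟨i, hij, hji, hsq⟩ := hv
  obtain ⟨i, rfl⟩ : ∃ i', i = b + i' := Nat.exists_eq_add_of_le (by omega)
  refine ⟨b' + i, by omega, by omega, fun k hk => ?_⟩
  have hletter := hsq k hk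
  simp only [add_assoc] at hletter ⊢
  rwa [deleteAt_add_congr h (by omega), deleteAt_add_congr h (by omega)] at hletter

theorem createsSquare_congr {v : ℕ → α} {b b' : ℕ} (hj : 2 * n ≤ j + 1)
    (h : ∀ k < j + 2 * n, v (b + k) = w (b' + k)) :
    CreatesSquare v (b + j) n ↔ CreatesSquare w (b' + j) n :=
  ⟨.of_agree hj h, .of_agree hj fun k hk => (h k hk).symm⟩

/-- The `m` letters to the left of position `j` determine the letter at `j`: wherever they occur
in `w`, the same letter follows. The condition is void if `j < m`. -/
def ForcedFromLeft (w : ℕ → α) (m j : ℕ) : Prop :=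
  ∀ k l, l + m = j → (∀ i < m, w (k + i) = w (l + i)) → w (k + m) = w j

/-- The `m` letters to the right of position `j` determine the letter at `j`: wherever they occur
in `w` away from its beginning, the same letter precedes. -/
def ForcedFromRight (w : ℕ → α) (m j : ℕ) : Prop :=
  ∀ k, (∀ i < m, w (k + 1 + i) = w (j + 1 + i)) → w k = w j

theorem IsSquarefree.not_factor_eq_deleteAt (hw : IsSquarefree w) {e p : ℕ} (hp : 0 < p)
    (hpn : p < n) (hl : ForcedFromLeft w m (e + p)) (hr : ForcedFromRight w m (e + p))
    (hn : 2 * m ≤ n + 1) (s : ℕ) : ¬∀ k < n, w (s + k) = deleteAt w (e + p) (e + k) := by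
  intro h
  have before {k : ℕ} (hk : k < p) : w (s + k) = w (e + k) := by
    rw [h k (by omega), deleteAt_of_lt (by omega)]
  have after {k : ℕ} (hk : p ≤ k) (hkn : k < n) : w (s + k) = w (e + k + 1) := by
    rw [h k hkn, deleteAt_of_le (by omega)]
  rcases le_or_gt m p with hm | hm
  · obtain ⟨d, rfl⟩ := Nat.exists_eq_add_of_le' hm
    have forced : w (s + (d + m)) = w (e + (d + m)) := by
      rw [← add_assoc s]
      refine hl (s + d) (e + d) (by omega) fun i hi => ?_
      rw [add_assoc, before (by omega), add_assoc]
    exact hw.ne_succ _ (forced.symm.trans (after le_rfl hpn))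
  · obtain ⟨d, rfl⟩ := Nat.exists_eq_add_of_le' hp
    have forced : w (s + d) = w (e + (d + 1)) := by
      refine hr (s + d) fun i hi => ?_
      rw [show s + d + 1 + i = s + (d + 1 + i) by ring, after (by omega) (by omega)]
      congr 1
      ring
    exact hw.ne_succ _ ((before (Nat.lt_succ_self d)).symm.trans forced)

theorem CreatesSquare.period_lt (h : CreatesSquare w j n) (hw : IsSquarefree w)
    (hl : ForcedFromLeft w m j) (hr : ForcedFromRight w m j) : n + 1 < 2 * m := by
  obtain ⟨i, hij, hji, hsq⟩ := h
  by_contra! hn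
  rcases le_or_gt j (i + n) with hj | hj
  · obtain ⟨p, rfl⟩ := Nat.exists_eq_add_of_le hij.le
    have copy : ∀ k < n, w (i + n + 1 + k) = deleteAt w (i + p) (i + k) := fun k hk => by
      rw [hsq k hk, deleteAt_of_le (by omega), add_right_comm]
    rcases (show p ≤ n by omega).lt_or_eq with hpn | rfl
    · exact hw.not_factor_eq_deleteAt (by omega) hpn hl hr hn _ copy
    · -- The deleted letter sits between the halves, and being forced it extends the first one.
      have left : ∀ k < p, w (i + p + 1 + k) = w (i + k) := fun k hk => by
        rw [copy k hk, deleteAt_of_lt (by omega)]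
      have forced : w (i + p + 1 + p) = w (i + p) := by
        obtain ⟨d, rfl⟩ : ∃ d, p = d + m := Nat.exists_eq_add_of_le' (by omega)
        rw [← add_assoc (_ + 1)]
        refine hl _ (i + d) (by omega) fun x hx => ?_
        rw [add_assoc, left _ (by omega), add_assoc]
      refine hw i (p + 1) (by omega) fun k hk => ?_
      rw [← add_assoc]
      rcases (Nat.lt_succ_iff.1 hk).lt_or_eq with hk | rfl
      · exact (left k hk).symm
      · exact forced.symm
  · obtain ⟨p, rfl⟩ := Nat.exists_eq_add_of_le hj.le
    refine hw.not_factor_eq_deleteAt (by omega) (by omega) hl hr hn i fun k hk => ?_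
    rw [← hsq k hk, deleteAt_of_lt (by omega)]

theorem IsSquarefree.isSquarefree_deleteAt_iff_of_forced (hw : IsSquarefree w)
    (hl : ForcedFromLeft w m j) (hr : ForcedFromRight w m j) :
    IsSquarefree (deleteAt w j) ↔ ∀ n, n + 1 < 2 * m → ¬CreatesSquare w j n := by
  rw [hw.isSquarefree_deleteAt_iff]
  exact ⟨fun h n _ => h n, fun h n hsq => h n (hsq.period_lt hw hl hr) hsq⟩

end Deletion

/-! ### The disposable positions of `vtm` -/

theorem eq_of_ne_of_ne {c d x y : Fin 3} (hcd : c ≠ d) (hxc : x ≠ c) (hxd : x ≠ d) (hyc : y ≠ c)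
    (hyd : y ≠ d) : x = y := by
  decide +revert

theorem forcedFromLeft_vtm {j : ℕ} (hj : Even j) : ForcedFromLeft vtm 3 j := by
  rintro k l rfl h
  have h₀ : vtm k = vtm l := h 0 (by omega)
  have h₁ : vtm (k + 1) = vtm (l + 1) := h 1 (by omega)
  have h₂ : vtm (k + 2) = vtm (l + 2) := h 2 (by omega)
  have hne := isSquarefree_vtm.ne_succ
  by_cases hlast : vtm (l + 2) = 1
  · exact eq_of_ne_of_ne (hne (l + 1)) (h₁ ▸ (vtm_ne_add_two_of_succ_eq_one (h₂ ▸ hlast)).symm)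
      (h₂ ▸ (hne (k + 2)).symm) (vtm_ne_add_two_of_succ_eq_one hlast).symm (hne (l + 2)).symm
  · have hfirst : vtm l = 1 := (vtm_eq_one_or_of_odd (by grind)).resolve_right hlast
    exact eq_of_ne_of_ne hlast (h₂ ▸ (hne (k + 2)).symm) (vtm_add_three_ne_one (h₀ ▸ hfirst))
      (hne (l + 2)).symm (vtm_add_three_ne_one hfirst)

theorem forcedFromRight_vtm {j : ℕ} (hj : Even j) : ForcedFromRight vtm 3 j := by
  intro k h
  have h₁ : vtm (k + 1) = vtm (j + 1) := h 0 (by omega)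
  have h₂ : vtm (k + 2) = vtm (j + 2) := h 1 (by omega)
  have h₃ : vtm (k + 3) = vtm (j + 3) := h 2 (by omega)
  have hne := isSquarefree_vtm.ne_succ
  by_cases hfirst : vtm (j + 1) = 1
  · exact eq_of_ne_of_ne (hne (j + 1)) (h₁ ▸ hne k)
      (h₂ ▸ vtm_ne_add_two_of_succ_eq_one (h₁ ▸ hfirst)) (hne j)
      (vtm_ne_add_two_of_succ_eq_one hfirst)
  · have hlast : vtm (j + 3) = 1 := (vtm_eq_one_or_of_odd hj.add_one).resolve_left hfirst
    exact eq_of_ne_of_ne hfirst (h₁ ▸ hne k) (fun hk => vtm_add_three_ne_one hk (h₃ ▸ hlast))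
      (hne j) (fun hj => vtm_add_three_ne_one hj hlast)

theorem isDisposable_vtm_iff_not_exists {j : ℕ} (hj : Odd j → ∃ n < 5, CreatesSquare vtm j n) :
    IsDisposable vtm j ↔ ¬∃ n < 5, CreatesSquare vtm j n := by
  simp only [IsDisposable, isSquarefree_vtm, true_and, not_exists, not_and]
  rcases Nat.even_or_odd j with heven | hodd
  · rw [isSquarefree_vtm.isSquarefree_deleteAt_iff_of_forced (forcedFromLeft_vtm heven)
      (forcedFromRight_vtm heven)]
    exact forall_congr' fun n => by rw [show n + 1 < 2 * 3 ↔ n < 5 by omega]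
  · obtain ⟨n, hn, hsq⟩ := hj hodd
    rw [isSquarefree_vtm.isSquarefree_deleteAt_iff]
    exact iff_of_false (fun h => h n hsq) (fun h => h n hn hsq)

theorem createsSquare_diffWord_of_lt_eight : ∀ j < 8,
    (∃ n < 5, CreatesSquare (diffWord thueMorse) j n) ↔ ¬(j = 0 ∨ j = 2) := by
  decide +kernel

theorem createsSquare_diffWord_eight_mul_add : ∀ m < 6, ∀ r < 8,
    (∃ n < 5, CreatesSquare (diffWord thueMorse) (8 * (m + 1) + r) n) ↔
      ¬(r = 2 ∧ diffWord thueMorse m = 1 ∨ r = 4 ∧ diffWord thueMorse (m + 1) = 1) := by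
  decide +kernel

theorem exists_lt_six_thueMorse_eq (m : ℕ) :
    ∃ m' < 6, ∀ i < 3, thueMorse (m + i) = thueMorse (m' + i) := by
  have cubefree_triples : ∀ a b c : Bool, a ≠ b ∨ b ≠ c → ∃ m' < 6,
      a = thueMorse m' ∧ b = thueMorse (m' + 1) ∧ c = thueMorse (m' + 2) := by
    decide +kernel
  obtain ⟨m', hm', h₀, h₁, h₂⟩ := cubefree_triples _ _ _ (thueMorse_ne_succ_or_succ_ne m)
  refine ⟨m', hm', fun i hi => ?_⟩
  interval_cases i
  exacts [h₀, h₁, h₂]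

theorem vtm_congr_of_thueMorse {m m' : ℕ} (h : thueMorse m = thueMorse m')
    (h' : thueMorse (m + 1) = thueMorse (m' + 1)) : vtm m = vtm m' := by
  rw [vtm_eq_diffWord, diffWord, diffWord, h, h']

theorem createsSquare_vtm_congr {m m' r n : ℕ}
    (h : ∀ i < 3, thueMorse (m + i) = thueMorse (m' + i)) (hr : r < 8) (hn : n < 5) :
    CreatesSquare vtm (8 * (m + 1) + r) n ↔ CreatesSquare vtm (8 * (m' + 1) + r) n := by
  rw [mul_add, mul_add, add_assoc, add_assoc]
  refine createsSquare_congr (by omega) fun k hk => vtm_congr_of_thueMorse ?_ ?_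
  · exact thueMorse_two_pow_mul_add_congr h 3 (by omega)
  · exact thueMorse_two_pow_mul_add_congr h 3 (k := k + 1) (by omega)

theorem exists_createsSquare_vtm_iff (m : ℕ) {r : ℕ} (hr : r < 8) :
    (∃ n < 5, CreatesSquare vtm (8 * (m + 1) + r) n) ↔
      ¬(r = 2 ∧ vtm m = 1 ∨ r = 4 ∧ vtm (m + 1) = 1) := by
  obtain ⟨m', hm', h⟩ := exists_lt_six_thueMorse_eq m
  have hvtm : vtm m = vtm m' := vtm_congr_of_thueMorse (h 0 (by omega)) (h 1 (by omega))
  have hvtm_succ : vtm (m + 1) = vtm (m' + 1) :=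
    vtm_congr_of_thueMorse (h 1 (by omega)) (h 2 (by omega))
  rw [exists_congr fun n => and_congr_right (createsSquare_vtm_congr h hr), hvtm, hvtm_succ,
    vtm_eq_diffWord]
  exact createsSquare_diffWord_eight_mul_add m' hm' r hr

theorem isDisposable_vtm_of_lt_eight {j : ℕ} (hj : j < 8) :
    IsDisposable vtm j ↔ j = 0 ∨ j = 2 := by
  have short := createsSquare_diffWord_of_lt_eight j hj
  rw [← vtm_eq_diffWord] at short
  rw [isDisposable_vtm_iff_not_exists fun hodd => short.2 (by grind), short, not_not]

theorem isDisposable_vtm_eight_mul_add (m : ℕ) {r : ℕ} (hr : r < 8) :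
    IsDisposable vtm (8 * (m + 1) + r) ↔ r = 2 ∧ vtm m = 1 ∨ r = 4 ∧ vtm (m + 1) = 1 := by
  have short := exists_createsSquare_vtm_iff m hr
  rw [isDisposable_vtm_iff_not_exists fun hodd => short.2 (by grind), short, not_not]

theorem lt_eight_or_exists_eq_eight_mul_add (j : ℕ) :
    j < 8 ∨ ∃ m r, r < 8 ∧ j = 8 * (m + 1) + r :=
  (lt_or_ge j 8).imp_right fun h => ⟨j / 8 - 1, j % 8, by omega, by omega⟩

theorem isDisposable_vtm_iff_exists (j : ℕ) :
    IsDisposable vtm j ↔ j = 0 ∨ j = 2 ∨ ∃ n, vtm n = 1 ∧ (j = 8 * n + 4 ∨ j = 8 * n + 10) := by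
  have hzero : vtm 0 ≠ 1 := vtm_two_mul_ne_one 0
  obtain hj | ⟨m, r, hr, rfl⟩ := lt_eight_or_exists_eq_eight_mul_add j
  · rw [isDisposable_vtm_of_lt_eight hj]
    refine or_congr_right ⟨Or.inl, Or.rec id ?_⟩
    rintro ⟨n, hn, hj'⟩
    obtain rfl : n = 0 := by omega
    exact absurd hn hzero
  · rw [isDisposable_vtm_eight_mul_add m hr]
    constructor
    · rintro (⟨rfl, hm⟩ | ⟨rfl, hm⟩)
      · exact Or.inr (Or.inr ⟨m, hm, by omega⟩)
      · exact Or.inr (Or.inr ⟨m + 1, hm, by omega⟩)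
    · rintro (h | h | ⟨n, hn, h | h⟩)
      · omega
      · omega
      · obtain rfl : n = m + 1 := by omega
        exact Or.inr ⟨by omega, hn⟩
      · obtain rfl : n = m := by omega
        exact Or.inl ⟨by omega, hn⟩

/-! ### The automaton -/

/-- The state of the automaton after reading the base-2 representation of `j`. -/
def dispoState (j : ℕ) : Fin 9 :=
  dispoPos.eval (binaryRep j)

instance : DecidablePred (· ∈ dispoPos.accept) := fun q =>
  inferInstanceAs (Decidable (q = 0 ∨ q = 2 ∨ q = 8))

theorem dispoState_bit (b : Bool) (j : ℕ) :
    dispoState (Nat.bit b j) = dispoPos.step (dispoState j) b := by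
  rcases eq_or_ne j 0 with rfl | hj
  · cases b <;> rfl
  · simp [dispoState, binaryRep, Nat.bits_append_bit j b fun h => absurd h hj]

theorem mem_accepts_iff_dispoState (j k : ℕ) :
    List.replicate k false ++ binaryRep j ∈ dispoPos.accepts ↔
      dispoState j ∈ dispoPos.accept := by
  have leading_zeros : dispoPos.eval (List.replicate k false) = dispoPos.start := by
    induction k with
    | zero => rfl
    | succ k ih => rw [List.replicate_succ', DFA.eval_append_singleton, ih]; rfl
  rw [DFA.mem_accepts, DFA.eval, DFA.evalFrom_of_append, ← DFA.eval, leading_zeros]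
  rfl

theorem dispoState_ne_zero {j : ℕ} (hj : j ≠ 0) : dispoState j ≠ 0 := by
  have step : ∀ q b, q ≠ 0 ∨ b = true → dispoPos.step q b ≠ 0 := by decide
  induction j using Nat.binaryRec' with
  | zero => exact absurd rfl hj
  | bit b j hb ih =>
    rw [dispoState_bit]
    exact step _ _ ((eq_or_ne j 0).symm.imp ih hb)

theorem vtm_eq_one_iff_dispoState (j : ℕ) :
    vtm j = 1 ↔ dispoState j = 1 ∨ dispoState j = 5 := by
  have step_false : ∀ q, ¬(dispoPos.step q false = 1 ∨ dispoPos.step q false = 5) := by decide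
  have step_true : ∀ q, (dispoPos.step q true = 1 ∨ dispoPos.step q true = 5) ↔
      ¬(q = 1 ∨ q = 5) := by decide
  induction j using Nat.binaryRec with
  | zero => decide
  | bit b j ih =>
    rw [dispoState_bit]
    cases b
    · exact iff_of_false (vtm_two_mul_ne_one j) (step_false _)
    · exact (vtm_two_mul_add_one_eq_one_iff j).trans (ih.not.trans (step_true _).symm)

theorem vtm_eq_one_iff_dispoState_succ (j : ℕ) :
    vtm j = 1 ↔ dispoState (j + 1) = 2 ∨ dispoState (j + 1) = 6 ∨ dispoState (j + 1) = 7 := by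
  have step_true : ∀ q, ¬(dispoPos.step q true = 2 ∨ dispoPos.step q true = 6 ∨
      dispoPos.step q true = 7) := by decide
  have step_false : ∀ q ≠ 0, (dispoPos.step q false = 2 ∨ dispoPos.step q false = 6 ∨
      dispoPos.step q false = 7) ↔ ¬(q = 2 ∨ q = 6 ∨ q = 7) := by decide
  induction j using Nat.binaryRec with
  | zero => decide
  | bit b j ih =>
    cases b
    · rw [show Nat.bit false j + 1 = Nat.bit true j from rfl, dispoState_bit]
      exact iff_of_false (vtm_two_mul_ne_one j) (step_true _)
    · rw [show Nat.bit true j + 1 = Nat.bit false (j + 1) from rfl, dispoState_bit]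
      exact (vtm_two_mul_add_one_eq_one_iff j).trans
        (ih.not.trans (step_false _ (dispoState_ne_zero j.succ_ne_zero)).symm)

theorem dispoState_eight_mul_add (m : ℕ) {r : ℕ} (hr : r < 8) : dispoState (8 * m + r) =
    dispoPos.evalFrom (dispoState m) [r.testBit 2, r.testBit 1, r.testBit 0] := by
  have digits : 8 * m + r =
      Nat.bit (r.testBit 0) (Nat.bit (r.testBit 1) (Nat.bit (r.testBit 2) m)) := by
    interval_cases r <;> simp [Nat.bit_val, Nat.testBit] <;> ring
  rw [digits, dispoState_bit, dispoState_bit, dispoState_bit]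
  rfl

theorem dispoState_eight_mul_add_mem_accept (m : ℕ) {r : ℕ} (hr : r < 8) :
    dispoState (8 * (m + 1) + r) ∈ dispoPos.accept ↔
      r = 2 ∧ vtm m = 1 ∨ r = 4 ∧ vtm (m + 1) = 1 := by
  have three_digits : ∀ q ≠ 0, ∀ r < 8,
      dispoPos.evalFrom q [r.testBit 2, r.testBit 1, r.testBit 0] ∈ dispoPos.accept ↔
        r = 2 ∧ (q = 2 ∨ q = 6 ∨ q = 7) ∨ r = 4 ∧ (q = 1 ∨ q = 5) := by
    decide +kernel
  rw [dispoState_eight_mul_add _ hr, three_digits _ (dispoState_ne_zero m.succ_ne_zero) r hr,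
    vtm_eq_one_iff_dispoState_succ, vtm_eq_one_iff_dispoState]

theorem dispoState_mem_accept_of_lt_eight : ∀ j < 8,
    dispoState j ∈ dispoPos.accept ↔ j = 0 ∨ j = 2 := by
  decide +kernel

theorem isDisposable_vtm_iff_dispoState (j : ℕ) :
    IsDisposable vtm j ↔ dispoState j ∈ dispoPos.accept := by
  obtain hj | ⟨m, r, hr, rfl⟩ := lt_eight_or_exists_eq_eight_mul_add j
  · rw [isDisposable_vtm_of_lt_eight hj, dispoState_mem_accept_of_lt_eight j hj]
  · rw [isDisposable_vtm_eight_mul_add m hr, dispoState_eight_mul_add_mem_accept m hr]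

/-! ### Gaps between disposable positions -/

/-- `i` and `i + g` are consecutive among the numbers with property `P`. -/
def IsGap (P : ℕ → Prop) (i g : ℕ) : Prop :=
  0 < g ∧ P i ∧ P (i + g) ∧ ∀ m, i < m → m < i + g → ¬P m

theorem IsGap.eq {P : ℕ → Prop} {i g g' : ℕ} (h : IsGap P i g) (h' : IsGap P i g') : g = g' := by
  obtain ⟨hg, -, hPg, hbetween⟩ := h
  obtain ⟨hg', -, hPg', hbetween'⟩ := h'
  rcases lt_trichotomy g g' with hlt | heq | hlt
  · exact absurd hPg (hbetween' _ (by omega) (by omega))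
  · exact heq
  · exact absurd hPg' (hbetween _ (by omega) (by omega))

theorem isGap_vtm_eq_one_two_or_four {n : ℕ} (hn : vtm n = 1) :
    IsGap (vtm · = 1) n 2 ∨ IsGap (vtm · = 1) n 4 := by
  have h₁ := vtm_succ_ne_one hn
  have h₃ := vtm_add_three_ne_one hn
  by_cases h₂ : vtm (n + 2) = 1
  · refine Or.inl ⟨two_pos, hn, h₂, fun m hm hm' => ?_⟩
    obtain rfl : m = n + 1 := by omega
    exact h₁
  · have h₄ : vtm (n + 2 + 2) = 1 :=
      (vtm_eq_one_or_of_odd ((odd_of_vtm_eq_one hn).add_even even_two)).resolve_left h₂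
    refine Or.inr ⟨four_pos, hn, h₄, fun m hm hm' => ?_⟩
    obtain rfl | rfl | rfl : m = n + 1 ∨ m = n + 2 ∨ m = n + 3 := by omega
    exacts [h₁, h₂, h₃]

theorem isGap_isDisposable_vtm_six {n : ℕ} (hn : vtm n = 1) :
    IsGap (IsDisposable vtm) (8 * n + 4) 6 := by
  simp only [IsGap, isDisposable_vtm_iff_exists]
  refine ⟨by omega, Or.inr (Or.inr ⟨n, hn, Or.inl rfl⟩),
    Or.inr (Or.inr ⟨n, hn, Or.inr (by omega)⟩), ?_⟩
  rintro m hm hm' (h | h | ⟨n', -, h⟩) <;> omega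

theorem IsGap.isDisposable_vtm {n d g : ℕ} (h : IsGap (vtm · = 1) n d) (hg : g + 6 = 8 * d) :
    IsGap (IsDisposable vtm) (8 * n + 10) g := by
  obtain ⟨hd, hn, hnd, hbetween⟩ := h
  simp only [IsGap, isDisposable_vtm_iff_exists]
  refine ⟨by linarith [hd], Or.inr (Or.inr ⟨n, hn, Or.inr rfl⟩),
    Or.inr (Or.inr ⟨n + d, hnd, Or.inl (by omega)⟩), ?_⟩
  rintro m hm hm' (h | h | ⟨n', hn', h⟩)
  · omega
  · omega
  · exact hbetween n' (by omega) (by omega) hn'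

theorem isGap_isDisposable_vtm_two_ten : IsGap (IsDisposable vtm) 2 10 := by
  have hzero : vtm 0 ≠ 1 := vtm_two_mul_ne_one 0
  refine ⟨by omega, (isDisposable_vtm_iff_exists 2).2 (Or.inr (Or.inl rfl)),
    (isDisposable_vtm_iff_exists 12).2 (Or.inr (Or.inr ⟨1, rfl, Or.inl rfl⟩)), ?_⟩
  intro m hm hm' h
  rcases (isDisposable_vtm_iff_exists m).1 h with h | h | ⟨n, hn, h⟩
  · omega
  · omega
  · obtain rfl : n = 0 := by omega
    exact hzero hn

theorem isGap_isDisposable_vtm_eighteen_twentySix : IsGap (IsDisposable vtm) 18 26 := by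
  have not_two : ¬IsGap (vtm · = 1) 1 2 := fun h =>
    (vtm_two_mul_add_one_eq_one_iff 1).1 h.2.2.1 rfl
  exact ((isGap_vtm_eq_one_two_or_four rfl).resolve_left not_two).isDisposable_vtm (by omega)

theorem IsGap.eq_six_or_ten_or_twentySix {i g : ℕ} (h : IsGap (IsDisposable vtm) i g)
    (hi : 0 < i) : g = 6 ∨ g = 10 ∨ g = 26 := by
  rcases (isDisposable_vtm_iff_exists i).1 h.2.1 with rfl | rfl | ⟨n, hn, rfl | rfl⟩
  · exact absurd hi (lt_irrefl 0)
  · exact Or.inr (Or.inl (h.eq isGap_isDisposable_vtm_two_ten))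
  · exact Or.inl (h.eq (isGap_isDisposable_vtm_six hn))
  · exact Or.inr ((isGap_vtm_eq_one_two_or_four hn).imp
      (fun h₂ => h.eq (h₂.isDisposable_vtm (by omega)))
      (fun h₄ => h.eq (h₄.isDisposable_vtm (by omega))))

end DisposableVtm

theorem mainTheorem2 :
    (∀ j k : ℕ, DisposableVtm.IsDisposable DisposableVtm.vtm j ↔
      List.replicate k false ++ DisposableVtm.binaryRep j ∈ DisposableVtm.dispoPos.accepts) ∧
    {g : ℕ | ∃ i j : ℕ, 0 < i ∧ i < j ∧ j = i + g ∧
      DisposableVtm.IsDisposable DisposableVtm.vtm i ∧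
      DisposableVtm.IsDisposable DisposableVtm.vtm j ∧
      ∀ m : ℕ, i < m → m < j → ¬ DisposableVtm.IsDisposable DisposableVtm.vtm m} =
      {6, 10, 26} := by
  open DisposableVtm in
  refine ⟨fun j k => by rw [isDisposable_vtm_iff_dispoState, mem_accepts_iff_dispoState], ?_⟩
  have realized {i g : ℕ} (hi : 0 < i) (h : IsGap (IsDisposable vtm) i g) :
      ∃ i j : ℕ, 0 < i ∧ i < j ∧ j = i + g ∧ IsDisposable vtm i ∧ IsDisposable vtm j ∧
        ∀ m : ℕ, i < m → m < j → ¬IsDisposable vtm m :=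
    ⟨i, i + g, hi, Nat.lt_add_of_pos_right h.1, rfl, h.2⟩
  ext g
  constructor
  · rintro ⟨i, _, hi, hlt, rfl, hdisposable⟩
    have gap : IsGap (IsDisposable vtm) i g := ⟨by omega, hdisposable⟩
    exact gap.eq_six_or_ten_or_twentySix hi
  · rintro (rfl | rfl | rfl)
    · exact realized (Nat.succ_pos _) (isGap_isDisposable_vtm_six (n := 1) rfl)
    · exact realized two_pos isGap_isDisposable_vtm_two_ten
    · exact realized (Nat.succ_pos _) isGap_isDisposable_vtm_eighteen_twentySix
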